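/- All categories, functors and natural transformations are enriched over the category $\mathsf{Pos}$ of posets and monotone maps: hom-sets are posets, composition is monotone, functors are monotone on hom-posets, and $\mathsf{Pos}$ itself carries the pointwise order on its hom-sets. Let $\Sigma$ be a finitary signature. An ordered $\Sigma$-algebra is a poset with monotone operations interpreting $\Sigma$; homomorphisms are the monotone maps preserving the operations, ordered pointwise. Let $\mathcal K$ be a variety of ordered $\Sigma$-algebras, i.e. the full subcategory of all ordered $\Sigma$-algebras satisfying a given set of inequations $s\le t$ between $\Sigma$-terms. Given a small category $\mathcal D$, a weight $W\colon\mathcal D^{\mathrm{op}}\to\mathsf{Pos}$ and a diagram $D\colon\mathcal D\to\mathcal L$, the weighted colimit $\operatorname{colim}_W D$ is an object with an isomorphism of posets $\mathcal L(\operatorname{colim}_W D,X)\cong[\mathcal D^{\mathrm{op}},\mathsf{Pos}](W,\mathcal L(D-,X))$ natural in $X$. The weight $W$ is called sifted if $W$-weighted colimits in $\mathsf{Pos}$ commute with finite products (including the empty one); a sifted colimit is a colimit weighted by a sifted weight. A filtered colimit is a colimit of a diagram whose domain is a small category $\mathcal D$ with filtered underlying category, weighted by the constant weight $1$. A coinserter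 of a parallel pair $u_0,u_1\colon U\to X$ is a morphism $f\colon X\to Y$ with $fu_0\le fu_1$ such that every $f'\colon X\to Y'$ with $f'u_0\le f'u_1$ factorizes as $f'=gf$ and such that, for all $g,\bar g\colon Y\to Y'$, $gf\le\bar gf$ implies $g\le\bar g$. A subregular epimorphism is a morphism that is a coinserter of some parallel pair. An object $A$ of $\mathcal K$ is called perfectly presentable, resp. finitely presentable, resp. a subregular projective, if its hom-functor $\mathcal K(A,-)\colon\mathcal K\to\mathsf{Pos}$ preserves sifted colimits, resp. filtered colimits, resp. subregular epimorphisms. The free algebra of $\mathcal K$ on a poset $P$ is an algebra $FP$ in $\mathcal K$ with a monotone map $\eta\colon P\to FP$ such that every monotone map from $P$ to (the underlying poset of) an algebra $X$ in $\mathcal K$ factorizes through $\eta$ by a unique homomorphism $FP\to X$. **Proposition.** For every algebra $A$ in a variety $\mathcal K$ of ordered algebras the following are equivalent: 1. $A$ is perfectly presentable; 2. $A$ is finitely presentable and a subregular projective; 3. $A$ is a retract, in $\mathcal K$, of a free algebra of $\mathcal K$ on a finite discrete poset. -/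

import Mathlib

open CategoryTheory Opposite

universe u v v₁ v₂ u₁ u₂

namespace PosEnriched

/-! ### Categories and functors enriched over posets -/

/-- A category enriched over the cartesian closed category of posets: every hom-set carries a
partial order and composition is monotone (in both variables). -/
class PosCategory (C : Type u₁) [Category.{v₁} C] where
  homOrder : ∀ X Y : C, PartialOrder (X ⟶ Y)
  comp_mono : ∀ {X Y Z : C} {f f' : X ⟶ Y} {g g' : Y ⟶ Z},
    f ≤ f' → g ≤ g' → f ≫ g ≤ f' ≫ g'

attribute [reducible, instance] PosCategory.homOrder

/-- A functor between poset-enriched categories is enriched iff it is monotone on hom-posets. -/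
class IsPosFunctor {C : Type u₁} [Category.{v₁} C] [PosCategory C]
    {D : Type u₂} [Category.{v₂} D] [PosCategory D] (F : C ⥤ D) : Prop where
  map_mono : ∀ {X Y : C} {f g : X ⟶ Y}, f ≤ g → F.map f ≤ F.map g

/-- The opposite category, with the same order on hom-sets. -/
instance opPosCategory (C : Type u₁) [Category.{v₁} C] [PosCategory C] : PosCategory Cᵒᵖ where
  homOrder X Y := PartialOrder.lift (fun f : X ⟶ Y => f.unop) Quiver.Hom.unop_inj
  comp_mono hf hg := PosCategory.comp_mono (C := C) hg hf

/-- The category of posets and monotone maps, with the pointwise order on hom-sets. -/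
instance partOrdPosCategory : PosCategory PartOrd.{u} where
  homOrder X Y := PartialOrder.lift (fun f : X ⟶ Y => f.hom) (fun _ _ h => PartOrd.hom_ext h)
  comp_mono {_ _ _ _ f'} {g _} hf hg :=
    fun x => le_trans (g.hom.monotone (hf x)) (hg (f'.hom x))

/-- A full subcategory, with the order on hom-sets of the ambient category. -/
instance fullSubcategoryPosCategory {C : Type u₁} [Category.{v₁} C] [PosCategory C]
    (P : ObjectProperty C) : PosCategory P.FullSubcategory where
  homOrder X Y := PartialOrder.lift (fun f : X ⟶ Y => f.hom)
    (fun _ _ h => ObjectProperty.hom_ext P h)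
  comp_mono hf hg := PosCategory.comp_mono (C := C) hf hg

/-- The enriched hom-functor `C(A, -)` with values in posets. -/
def homFunctor {C : Type u₁} [Category.{u} C] [PosCategory C] (A : C) : C ⥤ PartOrd.{u} where
  obj X := PartOrd.of (A ⟶ X)
  map f := PartOrd.ofHom ⟨fun g => g ≫ f, fun _ _ h => PosCategory.comp_mono h le_rfl⟩
  map_id X := by ext g; simp
  map_comp f g := by
    ext h
    exact (Category.assoc h f g).symm

instance {C : Type u₁} [Category.{u} C] [PosCategory C] (A : C) :
    IsPosFunctor (homFunctor A) where
  map_mono h := fun _ => PosCategory.comp_mono le_rfl h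

/-! ### Weighted colimits -/

section Weighted

variable {J : Type u} [Category.{u} J] [PosCategory J]
variable {C : Type u₁} [Category.{v₁} C] [PosCategory C]
variable {C' : Type u₂} [Category.{v₂} C'] [PosCategory C']

/-- A cocone weighted by `W` under the diagram `D`: an object `pt` with an enriched natural
transformation from `W` to `C(D -, pt)`. -/
structure WeightedCocone (W : Jᵒᵖ ⥤ PartOrd.{u}) (D : J ⥤ C) where
  pt : C
  leg : ∀ j : J, W.obj (op j) → (D.obj j ⟶ pt)
  leg_mono : ∀ j : J, Monotone (leg j)
  naturality : ∀ {i j : J} (f : i ⟶ j) (w : W.obj (op j)),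
    D.map f ≫ leg j w = leg i (W.map f.op w)

/-- `c` exhibits its vertex as the colimit of `D` weighted by `W`: for every object `X`, composition
with `c` is an isomorphism of posets from `C(c.pt, X)` to the poset of weighted cocones with
vertex `X`. (The first clause is surjectivity; the second one says that the order is reflected,
which includes injectivity; that the order is preserved is automatic.) -/
structure WeightedCocone.IsColimit {W : Jᵒᵖ ⥤ PartOrd.{u}} {D : J ⥤ C}
    (c : WeightedCocone W D) : Prop where
  exists_desc : ∀ s : WeightedCocone W D, ∃ g : c.pt ⟶ s.pt, ∀ j w, c.leg j w ≫ g = s.leg j w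
  le_of_le : ∀ {X : C} (g g' : c.pt ⟶ X), (∀ j w, c.leg j w ≫ g ≤ c.leg j w ≫ g') → g ≤ g'

/-- The image of a weighted cocone under an enriched functor. -/
def WeightedCocone.map {W : Jᵒᵖ ⥤ PartOrd.{u}} {D : J ⥤ C} (c : WeightedCocone W D)
    (F : C ⥤ C') [IsPosFunctor F] : WeightedCocone W (D ⋙ F) where
  pt := F.obj c.pt
  leg j w := F.map (c.leg j w)
  leg_mono j _ _ h := IsPosFunctor.map_mono (c.leg_mono j h)
  naturality {i j} f w := by
    rw [Functor.comp_map, ← F.map_comp, c.naturality]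

/-- `F` preserves colimits weighted by `W` (of all enriched diagrams, whenever they exist). -/
def PreservesWeightedColimits (F : C ⥤ C') [IsPosFunctor F] (W : Jᵒᵖ ⥤ PartOrd.{u}) : Prop :=
  ∀ (D : J ⥤ C) [IsPosFunctor D] (c : WeightedCocone W D), c.IsColimit → (c.map F).IsColimit

/-- The constant weight with value the one-element poset. Colimits with this weight are the conical
(unweighted) colimits. -/
def terminalWeight (J : Type u) [Category.{u} J] : Jᵒᵖ ⥤ PartOrd.{u} :=
  (Functor.const _).obj (PartOrd.of PUnit.{u + 1})

/-- The pointwise product of finitely many diagrams of posets. -/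
def prodDiagram {n : ℕ} (D : Fin n → (J ⥤ PartOrd.{u})) : J ⥤ PartOrd.{u} where
  obj j := PartOrd.of (∀ i, (D i).obj j)
  map f := PartOrd.ofHom
    ⟨fun x i => (D i).map f (x i), fun _ _ h i => ((D i).map f).hom.monotone (h i)⟩
  map_id j := by
    ext x i
    exact congrArg (fun m => m.hom (x i)) ((D i).map_id j)
  map_comp f g := by
    ext x i
    exact congrArg (fun m => m.hom (x i)) ((D i).map_comp f g)

/-- The cocone under the product diagram given by the products of the legs of the given cocones. -/
def prodCocone {n : ℕ} {W : Jᵒᵖ ⥤ PartOrd.{u}} (D : Fin n → (J ⥤ PartOrd.{u}))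
    (c : ∀ i, WeightedCocone W (D i)) : WeightedCocone W (prodDiagram D) where
  pt := PartOrd.of (∀ i, (c i).pt)
  leg j w := PartOrd.ofHom
    ⟨fun x i => (c i).leg j w (x i), fun _ _ h i => ((c i).leg j w).hom.monotone (h i)⟩
  leg_mono j _ _ h := fun x i => (c i).leg_mono j h (x i)
  naturality {i j} f w := by
    ext x k
    exact congrArg (fun m => m.hom (x k)) ((c k).naturality f w)

/-- A weight is sifted if colimits of diagrams of posets weighted by it commute with finite
products: for each finite family of diagrams with weighted colimits `(c i).pt`, the product of
these colimits is, via the products of the legs, the weighted colimit of the product diagram, i.e.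
the canonical map from the colimit of the product to the product of the colimits is an isomorphism.
(`n = 2` is the case of binary products, `n = 0` is the case of the terminal poset.) -/
def IsSiftedWeight (W : Jᵒᵖ ⥤ PartOrd.{u}) : Prop :=
  ∀ (n : ℕ) (D : Fin n → (J ⥤ PartOrd.{u})) (_ : ∀ i, IsPosFunctor (D i))
    (c : ∀ i, WeightedCocone W (D i)), (∀ i, (c i).IsColimit) → (prodCocone D c).IsColimit

end Weighted

/-! ### Subregular epimorphisms and properties of objects -/

/-- `f` is a coinserter of the pair `u₀, u₁`: it is universal with respect to
`f u₀ ≤ f u₁`, in the enriched sense. -/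
structure IsCoinserter {C : Type u₁} [Category.{v₁} C] [PosCategory C] {U X Y : C}
    (u₀ u₁ : U ⟶ X) (f : X ⟶ Y) : Prop where
  condition : u₀ ≫ f ≤ u₁ ≫ f
  exists_desc : ∀ {Z : C} (h : X ⟶ Z), u₀ ≫ h ≤ u₁ ≫ h → ∃ g : Y ⟶ Z, f ≫ g = h
  le_of_le : ∀ {Z : C} (g g' : Y ⟶ Z), f ≫ g ≤ f ≫ g' → g ≤ g'

/-- A subregular epimorphism is a coinserter of some parallel pair. -/
def IsSubregularEpi {C : Type u₁} [Category.{v₁} C] [PosCategory C] {X Y : C}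
    (f : X ⟶ Y) : Prop :=
  ∃ (U : C) (u₀ u₁ : U ⟶ X), IsCoinserter u₀ u₁ f

section Objects

variable {C : Type u₁} [Category.{u} C] [PosCategory C]

/-- The hom-functor of `A` into posets preserves sifted (weighted, small) colimits. -/
def IsPerfectlyPresentable (A : C) : Prop :=
  ∀ (J : Type u) [Category.{u} J] [PosCategory J] (W : Jᵒᵖ ⥤ PartOrd.{u}) [IsPosFunctor W],
    IsSiftedWeight W → PreservesWeightedColimits (homFunctor A) W

/-- The hom-functor of `A` into posets preserves (small) filtered colimits. -/
def IsFinitelyPresentable (A : C) : Prop :=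
  ∀ (J : Type u) [Category.{u} J] [PosCategory J] [IsFiltered J],
    PreservesWeightedColimits (homFunctor A) (terminalWeight J)

/-- The hom-functor of `A` into posets preserves subregular epimorphisms. -/
def IsSubregularProjective (A : C) : Prop :=
  ∀ {X Y : C} (e : X ⟶ Y), IsSubregularEpi e → IsSubregularEpi ((homFunctor A).map e)

end Objects

/-! ### Ordered algebras and their varieties -/

/-- An ordered algebra for the finitary signature given by the function symbols of `L`: a poset
with monotone operations. (`L` is going to have no relation symbols.) -/
structure OrdAlg (L : FirstOrder.Language.{u, v}) where
  carrier : Type u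
  [order : PartialOrder carrier]
  [str : L.Structure carrier]
  funMap_mono : ∀ {n : ℕ} (f : L.Functions n),
    Monotone (FirstOrder.Language.Structure.funMap f : (Fin n → carrier) → carrier)

attribute [instance] OrdAlg.order OrdAlg.str

namespace OrdAlg

variable {L : FirstOrder.Language.{u, v}}

/-- Monotone homomorphisms. -/
@[ext]
structure Hom (A B : OrdAlg L) where
  toOrderHom : A.carrier →o B.carrier
  map_fun : ∀ {n : ℕ} (f : L.Functions n) (x : Fin n → A.carrier),
    toOrderHom (FirstOrder.Language.Structure.funMap f x) =
      FirstOrder.Language.Structure.funMap f (fun i => toOrderHom (x i))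

instance : Category (OrdAlg L) where
  Hom A B := Hom A B
  id A := ⟨OrderHom.id, fun _ _ => rfl⟩
  comp f g := ⟨g.toOrderHom.comp f.toOrderHom, fun k x => by
    simp only [OrderHom.comp_coe, Function.comp_apply, f.map_fun, g.map_fun]⟩

/-- Ordered algebras form a poset-enriched category: homomorphisms are ordered pointwise. -/
instance : PosCategory (OrdAlg L) where
  homOrder A B := PartialOrder.lift (fun f : A ⟶ B => Hom.toOrderHom f) (fun _ _ h => Hom.ext h)
  comp_mono {_ _ _ _ f'} {g _} hf hg :=
    fun x => le_trans (g.toOrderHom.monotone (hf x)) (hg (f'.toOrderHom x))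

/-- `A` satisfies all inequations `s ≤ t` with `(s, t) ∈ E`, under every interpretation of the
variables. -/
def Satisfies (E : Set (L.Term ℕ × L.Term ℕ)) : ObjectProperty (OrdAlg L) :=
  fun A => ∀ p ∈ E, ∀ x : ℕ → A.carrier, p.1.realize x ≤ p.2.realize x

end OrdAlg

/-- The variety of ordered algebras presented by a set `E` of inequations between terms: the full
subcategory of the category of ordered algebras on those that satisfy `E`. -/
abbrev Variety {L : FirstOrder.Language.{u, v}} (E : Set (L.Term ℕ × L.Term ℕ)) :=
  (OrdAlg.Satisfies E).FullSubcategory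

section Free

variable {L : FirstOrder.Language.{u, v}} {E : Set (L.Term ℕ × L.Term ℕ)}

/-- `B` is, via `η`, a free algebra of the variety on the poset `P`. -/
def IsFreeOn (P : Type u) [PartialOrder P] (B : Variety E) (η : P →o B.obj.carrier) : Prop :=
  ∀ (X : Variety E) (f : P →o X.obj.carrier),
    ∃! h : B ⟶ X, ∀ p : P, h.hom.toOrderHom (η p) = f p

/-- `A` is a retract of a free algebra of the variety on a finite discrete poset. -/
def IsRetractOfFreeOnFiniteDiscrete (A : Variety E) : Prop :=
  ∃ (P : Type u) (_ : PartialOrder P) (B : Variety E) (η : P →o B.obj.carrier),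
    Finite P ∧ (∀ x y : P, x ≤ y → x = y) ∧ IsFreeOn P B η ∧ Nonempty (Retract A B)

end Free

end PosEnriched

/-!
The three conditions are proved equivalent in a cycle.

*Perfectly presentable objects are finitely presentable and subregular projectives.* The terminal
weight on a filtered category is sifted (`isSiftedWeight_terminalWeight`), since in a filtered
colimit of posets finitely many elements, and finitely many inequalities between them, live at a
common stage. For projectivity one uses reflexive coinserters: a subregular epimorphism `e` of a
variety is the same as a surjective homomorphism, and it is the reflexive coinserter of the algebra
of pairs `(x, x')` with `e x ≤ e x'`. Reflexive coinserters are colimits over a one-object category,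
whose morphisms are the monotone endomaps of the two-element chain, weighted by that chain itself
(`IntervalShape.weight`). This weight is sifted: thanks to reflexivity, the generating inequalities
of a product can be applied in one coordinate at a time. So the hom-functor of a perfectly
presentable algebra turns surjections into colimits, hence into surjections.

*Finitely presentable subregular projectives are retracts of free algebras.* An algebra `A` is a
quotient of the free algebra on its set of elements. Projectivity provides a section, and the
section factors through the free algebra on a finite subset, because a free algebra is the filtered
colimit of the free algebras on finite sets of generators (`isColimit_freeCocone`).

*Retracts of finitely generated free algebras are perfectly presentable.* For a sifted weight, powers
of a weighted colimit of underlying posets are again weighted colimits. Hence the operations of a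
diagram of algebras descend to the colimit, and the inequations hold there, as they involve
finitely many elements (`IsSiftedWeight.exists_algebra`). So the forgetful functor and its finite
powers preserve sifted colimits, and the hom-functor of a retract of the free algebra on `n`
generators is a retract of the `n`-th power of the forgetful functor.

Two devices avoid generating relations by hand. Preorders that present a quotient (a colimit of
posets, a free algebra) are defined by validity in all cocones, respectively in all algebras. And
information on a given colimit of posets is extracted by mapping it to the poset of truth values.
-/

namespace PosEnriched

/-! ### Weighted colimits of posets -/

/-- A subset of a poset on which the order between monotone maps is detected is the whole poset.
The maps that witness this for a point `p` are the characteristic functions of the principal upper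
set of `p` and of the upper set generated by those elements of the subset that lie above `p`. -/
theorem mem_of_detects_le {Y : PartOrd.{u}} (I : Set Y)
    (h : ∀ {Z : PartOrd.{u}} (g g' : Y ⟶ Z), (∀ y ∈ I, g y ≤ g' y) → g ≤ g') (p : Y) : p ∈ I := by
  let g : Y ⟶ PartOrd.of (ULift.{u} Prop) :=
    PartOrd.ofHom ⟨fun q => ⟨p ≤ q⟩, fun _ _ hq hp => le_trans hp hq⟩
  let g' : Y ⟶ PartOrd.of (ULift.{u} Prop) :=
    PartOrd.ofHom ⟨fun q => ⟨∃ i ∈ I, p ≤ i ∧ i ≤ q⟩,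
      fun _ _ hq ⟨i, hi, h₁, h₂⟩ => ⟨i, hi, h₁, le_trans h₂ hq⟩⟩
  have key : g ≤ g' := h g g' fun y hy hpy => ⟨y, hy, hpy, le_rfl⟩
  obtain ⟨i, hi, h₁, h₂⟩ := key p (le_refl p)
  exact le_antisymm h₂ h₁ ▸ hi

section Weighted

variable {J : Type u} [Category.{u} J] {W : Jᵒᵖ ⥤ PartOrd.{u}}

theorem WeightedCocone.naturality_apply {D : J ⥤ PartOrd.{u}} (c : WeightedCocone W D)
    {i j : J} (f : i ⟶ j) (w : W.obj (op j)) (x : D.obj i) :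
    c.leg j w (D.map f x) = c.leg i (W.map f.op w) x :=
  congrArg (fun m => m.hom x) (c.naturality f w)

theorem WeightedCocone.IsColimit.jointly_surjective {D : J ⥤ PartOrd.{u}}
    {c : WeightedCocone W D} (hc : c.IsColimit) (p : c.pt) : ∃ j w x, c.leg j w x = p :=
  mem_of_detects_le {p | ∃ j w x, c.leg j w x = p}
    (fun g g' h => hc.le_of_le g g' fun j w x => h _ ⟨j, w, x, rfl⟩) p

/-- A cocone of posets is a weighted colimit as soon as its legs are jointly surjective and each
inequality between values of the legs holds in all other cocones. -/
theorem WeightedCocone.isColimit_of_surjective {D : J ⥤ PartOrd.{u}} (c : WeightedCocone W D)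
    (hs : ∀ p : c.pt, ∃ j w x, c.leg j w x = p)
    (hle : ∀ (s : WeightedCocone W D) (i j : J) (w : W.obj (op i)) (v : W.obj (op j))
      (x : D.obj i) (y : D.obj j), c.leg i w x ≤ c.leg j v y → s.leg i w x ≤ s.leg j v y) :
    c.IsColimit where
  exists_desc s := by
    choose j w x h using hs
    refine ⟨PartOrd.ofHom ⟨fun p => s.leg (j p) (w p) (x p), fun p q hpq => ?_⟩, fun i v => ?_⟩
    · exact hle s _ _ _ _ _ _ (by rwa [h, h])
    · ext y
      exact le_antisymm (hle s _ _ _ _ _ _ (h _).le) (hle s _ _ _ _ _ _ (h _).ge)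
  le_of_le g g' hg p := by
    obtain ⟨j, w, x, rfl⟩ := hs p
    exact hg j w x

/-- The elements from which the weighted colimit of a diagram of posets is built. -/
def WeightedElement (W : Jᵒᵖ ⥤ PartOrd.{u}) (D : J ⥤ PartOrd.{u}) : Type u :=
  Σ j : J, W.obj (op j) × D.obj j

/-- One element is below another one if this is so in every weighted cocone. -/
instance (W : Jᵒᵖ ⥤ PartOrd.{u}) (D : J ⥤ PartOrd.{u}) : Preorder (WeightedElement W D) where
  le a b := ∀ s : WeightedCocone W D, s.leg a.1 a.2.1 a.2.2 ≤ s.leg b.1 b.2.1 b.2.2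
  le_refl _ _ := le_rfl
  le_trans _ _ _ h h' s := (h s).trans (h' s)

/-- The weighted colimit of a diagram of posets: the posetal reflection of the preorder of
weighted elements. -/
def colimitCocone (W : Jᵒᵖ ⥤ PartOrd.{u}) (D : J ⥤ PartOrd.{u}) : WeightedCocone W D where
  pt := PartOrd.of (Antisymmetrization (WeightedElement W D) (· ≤ ·))
  leg j w := PartOrd.ofHom ⟨fun x => toAntisymmetrization (· ≤ ·) (⟨j, w, x⟩ : WeightedElement W D),
    fun _ _ h s => (s.leg j w).hom.monotone h⟩
  leg_mono j _ _ h x s := s.leg_mono j h x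
  naturality {i j} f w := by
    ext x
    exact le_antisymm (fun s => (s.naturality_apply f w x).le)
      (fun s => (s.naturality_apply f w x).ge)

theorem isColimit_colimitCocone (W : Jᵒᵖ ⥤ PartOrd.{u}) (D : J ⥤ PartOrd.{u}) :
    (colimitCocone W D).IsColimit := by
  refine WeightedCocone.isColimit_of_surjective _ (fun p => ?_)
    (fun s i j w v x y h => h s)
  obtain ⟨⟨j, w, x⟩, rfl⟩ := Quotient.exists_rep p
  exact ⟨j, w, x, rfl⟩

/-- A cocone that is a retract, compatibly with all legs, of a weighted colimit is itself a
weighted colimit. -/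
theorem WeightedCocone.IsColimit.of_retract {D G : J ⥤ PartOrd.{u}} {c : WeightedCocone W D}
    {d : WeightedCocone W G} (hd : d.IsColimit) (α : D ⟶ G) (β : G ⟶ D) (hαβ : α ≫ β = 𝟙 D)
    (a : c.pt ⟶ d.pt) (b : d.pt ⟶ c.pt) (hab : a ≫ b = 𝟙 c.pt)
    (ha : ∀ j w, c.leg j w ≫ a = α.app j ≫ d.leg j w)
    (hb : ∀ j w, d.leg j w ≫ b = β.app j ≫ c.leg j w) : c.IsColimit where
  exists_desc s := by
    obtain ⟨g, hg⟩ := hd.exists_desc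
      { pt := s.pt
        leg := fun j w => β.app j ≫ s.leg j w
        leg_mono := fun j _ _ h => PosCategory.comp_mono le_rfl (s.leg_mono j h)
        naturality := fun f w => by rw [β.naturality_assoc, s.naturality] }
    refine ⟨a ≫ g, fun j w => ?_⟩
    rw [← Category.assoc, ha, Category.assoc, hg, ← Category.assoc, ← NatTrans.comp_app, hαβ]
    exact Category.id_comp _
  le_of_le g g' h := by
    have : b ≫ g ≤ b ≫ g' := hd.le_of_le _ _ fun j w => by
      rw [← Category.assoc, ← Category.assoc, hb, Category.assoc, Category.assoc]
      exact PosCategory.comp_mono le_rfl (h j w)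
    have := PosCategory.comp_mono (le_refl a) this
    rwa [← Category.assoc, ← Category.assoc, hab, Category.id_comp, Category.id_comp] at this

end Weighted

/-! ### Surjective monotone maps -/

theorem IsSubregularEpi.surjective {X Y : PartOrd.{u}} {f : X ⟶ Y} (hf : IsSubregularEpi f) :
    Function.Surjective f := by
  obtain ⟨U, u₀, u₁, h⟩ := hf
  exact fun p => mem_of_detects_le (Set.range f)
    (fun g g' hg => h.le_of_le g g' fun x => hg _ ⟨x, rfl⟩) p

/-- A surjective monotone map is the coinserter of the two projections of the poset of those pairs
that it makes comparable. -/
theorem isSubregularEpi_of_surjective {X Y : PartOrd.{u}} {f : X ⟶ Y}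
    (hf : Function.Surjective f) : IsSubregularEpi f := by
  refine ⟨PartOrd.of {p : X × X // f p.1 ≤ f p.2}, PartOrd.ofHom ⟨fun p => p.1.1, fun _ _ h => h.1⟩,
    PartOrd.ofHom ⟨fun p => p.1.2, fun _ _ h => h.2⟩, fun p => p.2, fun {Z} h hh => ?_,
    fun g g' hg p => ?_⟩
  · have key : ∀ x y, f x ≤ f y → h x ≤ h y := fun x y hxy => hh ⟨(x, y), hxy⟩
    choose r hr using hf
    refine ⟨PartOrd.ofHom ⟨fun p => h (r p), fun p q hpq => key _ _ (by rwa [hr, hr])⟩, ?_⟩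
    ext x
    exact le_antisymm (key _ _ (hr _).le) (key _ _ (hr _).ge)
  · obtain ⟨x, rfl⟩ := hf p
    exact hg x

/-! ### Filtered categories have sifted terminal weight -/

section Filtered

variable {J : Type u} [Category.{u} J] [IsFiltered J]

/-- In a filtered colimit of posets, an inequality between the images of two elements of the same
stage already holds at a later stage. It is read off from the cocone of truth values that sends an
element `y` to the assertion that `x ≤ y` holds at a later stage. -/
theorem WeightedCocone.IsColimit.exists_le_of_leg_le {D : J ⥤ PartOrd.{u}}
    {c : WeightedCocone (terminalWeight J) D} (hc : c.IsColimit) {m : J} {x y : D.obj m}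
    (hxy : c.leg m ⟨⟩ x ≤ c.leg m ⟨⟩ y) : ∃ (k : J) (f : m ⟶ k), D.map f x ≤ D.map f y := by
  obtain ⟨g, hg⟩ := hc.exists_desc
    { pt := PartOrd.of (ULift.{u} Prop)
      leg := fun j _ => PartOrd.ofHom
        ⟨fun z => ⟨∃ (k : J) (f : m ⟶ k) (g : j ⟶ k), D.map f x ≤ D.map g z⟩,
          fun _ _ hz ⟨k, f, g, h⟩ => ⟨k, f, g, h.trans ((D.map g).hom.monotone hz)⟩⟩
      leg_mono := fun _ _ _ _ => le_rfl
      naturality := fun {i j} f _ => by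
        ext z
        refine ⟨?_, ?_⟩
        · rintro ⟨k, a, b, h⟩
          refine ⟨k, a, f ≫ b, ?_⟩
          rw [D.map_comp]
          exact h
        · rintro ⟨k, a, b, h⟩
          obtain ⟨l, p, q, hpq⟩ := IsFiltered.span b f
          refine ⟨l, a ≫ p, q, ?_⟩
          have h' := (D.map p).hom.monotone h
          have e : D.map p (D.map b z) = D.map q (D.map f z) := by
            rw [← ConcreteCategory.comp_apply, ← ConcreteCategory.comp_apply, ← D.map_comp,
              ← D.map_comp, hpq]
          rw [D.map_comp]
          exact h'.trans e.le }
  have h := g.hom.monotone hxy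
  have e : ∀ z : D.obj m, g (c.leg m ⟨⟩ z) =
      ⟨∃ (k : J) (f : m ⟶ k) (g : m ⟶ k), D.map f x ≤ D.map g z⟩ :=
    fun z => congrArg (fun t => t.hom z) (hg m ⟨⟩)
  have h' : (g (c.leg m ⟨⟩ x)).down → (g (c.leg m ⟨⟩ y)).down := h
  rw [e, e] at h'
  obtain ⟨k, a, b, hk⟩ := h' ⟨m, 𝟙 m, 𝟙 m, le_rfl⟩
  -- the two morphisms to the later stage are parallel, hence equal at a still later one
  refine ⟨IsFiltered.coeq a b, a ≫ IsFiltered.coeqHom a b, ?_⟩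
  conv_rhs => rw [IsFiltered.coeq_condition a b]
  rw [D.map_comp, D.map_comp]
  exact (D.map (IsFiltered.coeqHom a b)).hom.monotone hk

/-- Finitely many inequalities that hold at later stages hold at a common later stage. -/
theorem exists_common_le {n : ℕ} (D : Fin n → (J ⥤ PartOrd.{u})) {m : J}
    (x y : ∀ i, (D i).obj m)
    (h : ∀ i, ∃ (k : J) (f : m ⟶ k), (D i).map f (x i) ≤ (D i).map f (y i)) (S : Finset (Fin n)) :
    ∃ (k : J) (f : m ⟶ k), ∀ i ∈ S, (D i).map f (x i) ≤ (D i).map f (y i) := by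
  have step : ∀ {k l : J} (f : m ⟶ k) (g : k ⟶ l) (i : Fin n),
      (D i).map f (x i) ≤ (D i).map f (y i) →
      (D i).map (f ≫ g) (x i) ≤ (D i).map (f ≫ g) (y i) := fun f g i hi => by
    rw [(D i).map_comp]
    exact ((D i).map g).hom.monotone hi
  induction S using Finset.induction_on with
  | empty => exact ⟨m, 𝟙 m, by simp⟩
  | insert a S _ ih =>
    obtain ⟨k, f, hf⟩ := ih
    obtain ⟨l, g, hg⟩ := h a
    obtain ⟨q, p, r, hpr⟩ := IsFiltered.span f g
    refine ⟨q, f ≫ p, fun i hi => ?_⟩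
    rcases Finset.mem_insert.1 hi with rfl | hi
    · rw [hpr]
      exact step g r _ hg
    · exact step f p _ (hf i hi)

theorem isSiftedWeight_terminalWeight [PosCategory J] : IsSiftedWeight (terminalWeight J) := by
  intro n D _ c hc
  have nat : ∀ (s : WeightedCocone (terminalWeight J) (prodDiagram D)) {i j : J} (f : i ⟶ j)
      (x : ∀ k, (D k).obj i), s.leg i ⟨⟩ x = s.leg j ⟨⟩ (fun k => (D k).map f (x k)) :=
    fun s i j f x => (s.naturality_apply f ⟨⟩ x).symm
  refine WeightedCocone.isColimit_of_surjective _ (fun p => ?_) ?_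
  · -- representatives of the components of `p` are moved to a common stage
    choose j w x hx using fun i => (hc i).jointly_surjective (p i)
    classical
    obtain ⟨k, hk⟩ := IsFiltered.sup_objs_exists (Finset.univ.image j)
    have f : ∀ i, j i ⟶ k := fun i =>
      (hk (Finset.mem_image_of_mem j (Finset.mem_univ i))).some
    refine ⟨k, ⟨⟩, fun i => (D i).map (f i) (x i), ?_⟩
    funext i
    exact ((c i).naturality_apply (f i) ⟨⟩ (x i)).trans (hx i)
  · rintro s i j ⟨⟩ ⟨⟩ x y h
    have a := IsFiltered.leftToMax i j
    have b := IsFiltered.rightToMax i j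
    have h' : ∀ k, (c k).leg _ ⟨⟩ ((D k).map a (x k)) ≤ (c k).leg _ ⟨⟩ ((D k).map b (y k)) :=
      fun k => ((c k).naturality_apply a ⟨⟩ (x k)).trans_le
        ((h k).trans_eq ((c k).naturality_apply b ⟨⟩ (y k)).symm)
    obtain ⟨l, f, hf⟩ := exists_common_le D _ _
      (fun k => (hc k).exists_le_of_leg_le (h' k)) Finset.univ
    refine ((nat s a x).trans (nat s f _)).trans_le (le_of_le_of_eq ?_
      ((nat s b y).trans (nat s f _)).symm)
    exact (s.leg l ⟨⟩).hom.monotone fun k => hf k (Finset.mem_univ k)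

end Filtered

/-! ### A sifted weight for reflexive coinserters -/

/-- The one-object category whose morphisms are the monotone endomaps of the two-element chain,
composed in the opposite order. A diagram of this shape is a reflexive pair, presented by the
action of the two constant maps on its object of arrows. -/
inductive IntervalShape : Type u
  | star

namespace IntervalShape

instance : Category.{u} IntervalShape.{u} where
  Hom _ _ := ULift.{u} Bool →o ULift.{u} Bool
  id _ := OrderHom.id
  comp f g := f.comp g

/-- The discrete order on the morphisms: diagrams need not be compatible with the pointwise one. -/
instance : PosCategory IntervalShape.{u} where
  homOrder _ _ :=
    { le := Eq
      le_refl := fun _ => rfl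
      le_trans := fun _ _ _ => Eq.trans
      le_antisymm := fun _ _ h _ => h }
  comp_mono := by
    rintro _ _ _ _ _ _ _ rfl rfl
    rfl

theorem isPosFunctor {C : Type u₁} [Category.{v₁} C] [PosCategory C] (F : IntervalShape.{u} ⥤ C) :
    IsPosFunctor F where
  map_mono := by
    rintro _ _ _ _ rfl
    exact le_rfl

/-- The tautological action on the two-element chain. Colimits with this weight are reflexive
coinserters. -/
def weight : IntervalShape.{u}ᵒᵖ ⥤ PartOrd.{u} where
  obj _ := PartOrd.of (ULift.{u} Bool)
  map f := PartOrd.ofHom f.unop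

instance : IsPosFunctor weight.{u} where
  map_mono := by
    intro _ _ f g h
    have h' : f.unop = g.unop := h
    rw [Quiver.Hom.unop_inj h']

/-- The endomorphism given by a constant map. -/
def const (w : ULift.{u} Bool) : star.{u} ⟶ star := OrderHom.const _ w

theorem map_const_map {D : IntervalShape.{u} ⥤ PartOrd.{u}} (f : star.{u} ⟶ star)
    (w : ULift.{u} Bool) (x : D.obj star) :
    D.map (const w) (D.map f x) = D.map (const (OrderHom.toFun f w)) x := by
  rw [← ConcreteCategory.comp_apply, ← D.map_comp]
  rfl

theorem map_map_const {D : IntervalShape.{u} ⥤ PartOrd.{u}} (f : star.{u} ⟶ star)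
    (w : ULift.{u} Bool) (x : D.obj star) :
    D.map f (D.map (const w) x) = D.map (const w) x := by
  rw [← ConcreteCategory.comp_apply, ← D.map_comp]
  rfl

theorem leg_map {D : IntervalShape.{u} ⥤ PartOrd.{u}} (c : WeightedCocone weight D)
    (v w : ULift.{u} Bool) (x : D.obj star) :
    c.leg star v (D.map (const w) x) = c.leg star w x :=
  c.naturality_apply (const w) v x

/-- Let `s` be a cocone under a product of diagrams, and fix a family `z` of elements on which the
constant maps act trivially, that is, of degenerate arrows. If the `i`-th component is replaced by
the degenerate arrow given by the `w`-end of `x`, then the value of `s` depends monotonically on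
the image of `(w, x)` in the colimit of the `i`-th diagram: as the other components are degenerate,
this dependence is a cocone under the `i`-th diagram. -/
theorem leg_update_le {n : ℕ} {D : Fin n → (IntervalShape.{u} ⥤ PartOrd.{u})}
    {i : Fin n} {c : WeightedCocone weight (D i)} (hc : c.IsColimit)
    (s : WeightedCocone weight (prodDiagram D)) (z : ∀ k, (D k).obj star)
    (hz : ∀ k w, (D k).map (const w) (z k) = z k) {w v : ULift.{u} Bool} {x y : (D i).obj star}
    (h : c.leg star w x ≤ c.leg star v y) (b : ULift.{u} Bool) :
    s.leg star b (Function.update z i ((D i).map (const w) x)) ≤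
      s.leg star b (Function.update z i ((D i).map (const v) y)) := by
  have upd : ∀ (w : ULift.{u} Bool) (x : (D i).obj star),
      s.leg star b (Function.update z i ((D i).map (const w) x)) =
        s.leg star w (Function.update z i x) := by
    intro w x
    rw [← leg_map s b w (Function.update z i x)]
    congr 1
    funext k
    change _ = (D k).map (const w) (Function.update z i x k)
    by_cases hk : k = i
    · subst hk
      simp
    · simp [hk, hz]
  obtain ⟨g, hg⟩ := hc.exists_desc
    { pt := s.pt
      leg := fun j w => PartOrd.ofHom
        ⟨fun x => s.leg star w (Function.update z i x),
          fun _ _ h => (s.leg star w).hom.monotone (Function.update_mono h)⟩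
      leg_mono := fun j _ _ h x => s.leg_mono star h _
      naturality := fun {_ _} f w => by
        ext x
        refine (upd _ _).symm.trans (Eq.trans ?_ (upd _ _))
        exact congrArg (fun t => s.leg star b (Function.update z i t))
          (map_const_map (D := D i) f w x) }
  have e : ∀ w x, g (c.leg star w x) = s.leg star w (Function.update z i x) :=
    fun w x => congrArg (fun t => t.hom x) (hg star w)
  rw [upd, upd]
  exact (e w x).symm.trans_le ((g.hom.monotone h).trans_eq (e v y))

theorem isSiftedWeight_weight : IsSiftedWeight weight.{u} := by
  intro n D _ c hc
  refine WeightedCocone.isColimit_of_surjective _ (fun p => ?_) ?_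
  · choose j w x hx using fun i => (hc i).jointly_surjective (p i)
    refine ⟨star, ⟨false⟩, fun i => (D i).map (const (w i)) (x i), ?_⟩
    funext i
    exact (leg_map (c i) _ _ _).trans (hx i)
  · rintro s ⟨⟩ ⟨⟩ w v x y h
    let X : ∀ k, (D k).obj star := fun k => (D k).map (const w) (x k)
    let Y : ∀ k, (D k).obj star := fun k => (D k).map (const v) (y k)
    -- the components are replaced one after the other
    have key : ∀ S : Finset (Fin n), s.leg star w X ≤ s.leg star w (S.piecewise Y X) := by
      intro S
      induction S using Finset.induction_on with
      | empty => simp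
      | insert a S ha ih =>
        refine ih.trans ?_
        have hz : ∀ k w, (D k).map (const w) (S.piecewise Y X k) = S.piecewise Y X k := by
          intro k w
          by_cases hk : k ∈ S
          · simp only [hk, Finset.piecewise_eq_of_mem]
            exact map_map_const _ _ _
          · simp only [hk, Finset.piecewise_eq_of_notMem, not_false_eq_true]
            exact map_map_const _ _ _
        have := leg_update_le (hc a) s (S.piecewise Y X) hz (h a) w
        rw [Finset.piecewise_insert]
        refine le_trans (le_of_eq ?_) this
        congr 1
        exact (Function.update_eq_self_iff.2
          (Finset.piecewise_eq_of_notMem S Y X ha).symm).symm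
    have := key Finset.univ
    rw [Finset.piecewise_univ] at this
    calc s.leg star w x = s.leg star w X := (leg_map s w w x).symm
      _ ≤ s.leg star w Y := this
      _ = s.leg star v y := leg_map s w v y

end IntervalShape

open FirstOrder.Language.Structure (funMap)

variable {L : FirstOrder.Language.{u, v}} {E : Set (L.Term ℕ × L.Term ℕ)}

/-! ### Homomorphisms and surjections in a variety -/

namespace OrdAlg

theorem Hom.map_realize {A B : OrdAlg L} (f : Hom A B) {α : Type*} (t : L.Term α)
    (x : α → A.carrier) :
    f.toOrderHom (t.realize x) = t.realize fun a => f.toOrderHom (x a) := by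
  induction t with
  | var a => rfl
  | func F ts ih =>
    simp only [FirstOrder.Language.Term.realize_func, f.map_fun, ih]

theorem realize_mono {A : OrdAlg L} {α : Type*} (t : L.Term α) {x y : α → A.carrier}
    (h : x ≤ y) : t.realize x ≤ t.realize y := by
  induction t with
  | var a => exact h a
  | func F ts ih => exact A.funMap_mono F ih

/-- Inequations are inherited along homomorphisms that jointly reflect the order. -/
theorem satisfies_of_reflects {T : OrdAlg L} {ι : Sort*} (X : ι → Variety E)
    (m : ∀ i, Hom T (X i).obj)
    (h : ∀ a b, (∀ i, (m i).toOrderHom a ≤ (m i).toOrderHom b) → a ≤ b) : Satisfies E T := by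
  intro p hp x
  refine h _ _ fun i => ?_
  rw [Hom.map_realize, Hom.map_realize]
  exact (X i).property p hp _

end OrdAlg

namespace Variety

/-- The monotone map underlying a homomorphism in a variety. -/
abbrev app {X Y : Variety E} (f : X ⟶ Y) : X.obj.carrier →o Y.obj.carrier :=
  f.hom.toOrderHom

/-- The homomorphism with the given underlying monotone map. -/
def mkHom {X Y : Variety E} (f : X.obj.carrier →o Y.obj.carrier)
    (hf : ∀ {n : ℕ} (F : L.Functions n) (x : Fin n → X.obj.carrier),
      f (funMap F x) = funMap F (fun i => f (x i))) : X ⟶ Y :=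
  ObjectProperty.homMk ⟨f, hf⟩

theorem hom_ext_app {X Y : Variety E} {f g : X ⟶ Y} (h : ∀ x, app f x = app g x) : f = g :=
  ObjectProperty.hom_ext _ (OrdAlg.Hom.ext (OrderHom.ext _ _ (funext h)))

theorem app_comp {X Y Z : Variety E} (f : X ⟶ Y) (g : Y ⟶ Z) (x : X.obj.carrier) :
    app (f ≫ g) x = app g (app f x) := rfl

theorem app_funMap {X Y : Variety E} (f : X ⟶ Y) {n : ℕ} (F : L.Functions n)
    (x : Fin n → X.obj.carrier) : app f (funMap F x) = funMap F (fun i => app f (x i)) :=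
  f.hom.map_fun F x

/-- The underlying poset of an algebra, as a functor. -/
def forget (E : Set (L.Term ℕ × L.Term ℕ)) : Variety E ⥤ PartOrd.{u} where
  obj X := PartOrd.of X.obj.carrier
  map f := PartOrd.ofHom (app f)

instance : IsPosFunctor (forget E) where
  map_mono h := h

/-- A homomorphism whose order kernel contains that of a surjective homomorphism `e` factors
through `e`. -/
theorem exists_factor {X Y Z : Variety E} {e : X ⟶ Y} (he : Function.Surjective (app e))
    (k : X ⟶ Z) (hk : ∀ x x', app e x ≤ app e x' → app k x ≤ app k x') :
    ∃ g : Y ⟶ Z, e ≫ g = k := by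
  choose r hr using he
  have hkr : ∀ x, app k (r (app e x)) = app k x := fun x =>
    le_antisymm (hk _ _ (hr _).le) (hk _ _ (hr _).ge)
  refine ⟨mkHom ⟨fun y => app k (r y), fun y y' h => hk _ _ (by rwa [hr, hr])⟩ fun F y => ?_,
    hom_ext_app hkr⟩
  have : funMap F y = app e (funMap F fun i => r (y i)) := by
    rw [app_funMap]
    simp only [hr]
  change app k (r (funMap F y)) = funMap F fun i => app k (r (y i))
  rw [this, hkr, app_funMap]

theorem le_of_surjective {X Y Z : Variety E} {e : X ⟶ Y} (he : Function.Surjective (app e))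
    {g g' : Y ⟶ Z} (h : e ≫ g ≤ e ≫ g') : g ≤ g' := by
  intro y
  obtain ⟨x, rfl⟩ := he y
  exact h x

/-- The image of a homomorphism, with the order and the operations of the codomain. -/
def range {X Y : Variety E} (e : X ⟶ Y) : Variety E :=
  letI str : L.Structure (Set.range (app e)) :=
    { funMap := fun F y => ⟨funMap F fun i => (y i).1, funMap F fun i => (y i).2.choose, by
        rw [app_funMap]
        exact congrArg _ (funext fun i => (y i).2.choose_spec)⟩
      RelMap := fun _ _ => False }
  let T : OrdAlg L :=
    { carrier := Set.range (app e)
      funMap_mono := fun F _ _ h => Y.obj.funMap_mono F h }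
  ⟨T, OrdAlg.satisfies_of_reflects (ι := Unit) (fun _ => Y)
    (fun _ => ⟨⟨Subtype.val, fun _ _ h => h⟩, fun _ _ => rfl⟩) fun _ _ h => h ()⟩

/-- The algebra of those pairs of elements of the domain of a homomorphism `e` whose images under
`e` form an increasing pair. Pairs are encoded as functions on the two-element chain, so that
its endomaps act on them. -/
def orderKernel {X Y : Variety E} (e : X ⟶ Y) : Variety E :=
  letI str : L.Structure {t : ULift.{u} Bool → X.obj.carrier // Monotone fun w => app e (t w)} :=
    { funMap := fun F t => ⟨fun w => funMap F fun i => (t i).1 w, fun w w' h => by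
        simp only [app_funMap]
        exact Y.obj.funMap_mono F fun i => (t i).2 h⟩
      RelMap := fun _ _ => False }
  let T : OrdAlg L :=
    { carrier := {t : ULift.{u} Bool → X.obj.carrier // Monotone fun w => app e (t w)}
      funMap_mono := fun F _ _ h w => X.obj.funMap_mono F fun i => Subtype.coe_le_coe.2 (h i) w }
  ⟨T, OrdAlg.satisfies_of_reflects (ι := ULift.{u} Bool) (fun _ => X)
    (fun w => ⟨⟨fun t => t.1 w, fun _ _ h => h w⟩, fun _ _ => rfl⟩) fun _ _ h => h⟩

section OrderKernel

variable {X Y : Variety E} (e : X ⟶ Y)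

/-- The projections of the order kernel. -/
def orderKernelProj (w : ULift.{u} Bool) : orderKernel e ⟶ X :=
  mkHom ⟨fun t => t.1 w, fun _ _ h => h w⟩ fun _ _ => rfl

/-- The diagonal of the order kernel. -/
def orderKernelDiag : X ⟶ orderKernel e :=
  mkHom ⟨fun x => ⟨fun _ => x, fun _ _ _ => le_rfl⟩, fun _ _ h _ => h⟩ fun _ _ => rfl

/-- The pair of two elements with comparable images. -/
def orderKernelPair {x x' : X.obj.carrier} (h : app e x ≤ app e x') :
    (orderKernel e).obj.carrier :=
  ⟨fun w => if w.down then x' else x, by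
    rintro ⟨_ | _⟩ ⟨_ | _⟩ hw
    · exact le_rfl
    · exact h
    · exact absurd (show true ≤ false from hw) (by decide)
    · exact le_rfl⟩

theorem orderKernelProj_comp_le :
    orderKernelProj e ⟨false⟩ ≫ e ≤ orderKernelProj e ⟨true⟩ ≫ e :=
  fun t => t.2 (show (⟨false⟩ : ULift.{u} Bool) ≤ ⟨true⟩ from Bool.false_le _)

end OrderKernel

/-- In a variety, the subregular epimorphisms are the surjective homomorphisms; such a homomorphism
is the coinserter of the projections of its order kernel. -/
theorem isSubregularEpi_iff_surjective {X Y : Variety E} (e : X ⟶ Y) :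
    IsSubregularEpi e ↔ Function.Surjective (app e) := by
  constructor
  · rintro ⟨U, u₀, u₁, h⟩
    -- `e` factors through its image, and the inclusion of the image is split
    let k : X ⟶ range e :=
      mkHom ⟨fun x => ⟨app e x, x, rfl⟩, fun _ _ h => (app e).monotone h⟩
        fun F x => Subtype.ext (app_funMap e F x)
    let m : range e ⟶ Y := mkHom ⟨Subtype.val, fun _ _ h => h⟩ fun _ _ => rfl
    obtain ⟨g, hg⟩ := h.exists_desc k h.condition
    have hgm : e ≫ g ≫ m = e ≫ 𝟙 Y := by
      rw [← Category.assoc, hg, Category.comp_id]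
      rfl
    have := le_antisymm (h.le_of_le _ _ hgm.le) (h.le_of_le _ _ hgm.ge)
    intro y
    obtain ⟨x, hx⟩ := (app g y).2
    exact ⟨x, hx.trans (congrArg (fun t => app t y) this)⟩
  · intro he
    refine ⟨orderKernel e, orderKernelProj e ⟨false⟩, orderKernelProj e ⟨true⟩,
      orderKernelProj_comp_le e, fun k hk => exists_factor he k fun x x' h => ?_,
      fun g g' h => le_of_surjective he h⟩
    exact hk (orderKernelPair e h)

/-! ### Free algebras -/

/-- Terms with variables in `α`, as representatives of the elements of a free algebra. -/
def FreeTerm (_ : Set (L.Term ℕ × L.Term ℕ)) (α : Type u) : Type u := L.Term α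

/-- A term is below another one if this is so under all interpretations in algebras of the
variety. -/
instance (α : Type u) : Preorder (FreeTerm E α) where
  le s t := ∀ (X : Variety E) (x : α → X.obj.carrier),
    FirstOrder.Language.Term.realize x s ≤ FirstOrder.Language.Term.realize x t
  le_refl _ _ _ := le_rfl
  le_trans _ _ _ h h' X x := (h X x).trans (h' X x)

/-- The underlying poset of the free algebra on a set: terms modulo inequations that are valid in
the variety. -/
abbrev FreeCarrier (E : Set (L.Term ℕ × L.Term ℕ)) (α : Type u) : Type u :=
  Antisymmetrization (FreeTerm E α) (· ≤ ·)

section FreeTerm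

variable {α : Type u}

/-- The class of a term in the free algebra. -/
def termClass (E : Set (L.Term ℕ × L.Term ℕ)) (t : L.Term α) : FreeCarrier E α :=
  toAntisymmetrization (α := FreeTerm E α) (· ≤ ·) t

/-- A term that represents an element of the free algebra. -/
noncomputable def termRep (q : FreeCarrier E α) : L.Term α :=
  ofAntisymmetrization (α := FreeTerm E α) (· ≤ ·) q

theorem termClass_le_iff {s t : L.Term α} : termClass E s ≤ termClass E t ↔
    ∀ (X : Variety E) (x : α → X.obj.carrier), s.realize x ≤ t.realize x :=
  Iff.rfl

theorem termClass_termRep (q : FreeCarrier E α) : termClass E (termRep q) = q :=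
  toAntisymmetrization_ofAntisymmetrization (α := FreeTerm E α) (· ≤ ·) q

theorem termClass_func_mono {n : ℕ} (F : L.Functions n) {s t : Fin n → L.Term α}
    (h : ∀ i, termClass E (s i) ≤ termClass E (t i)) :
    termClass E (FirstOrder.Language.Term.func F s) ≤
      termClass E (FirstOrder.Language.Term.func F t) :=
  termClass_le_iff.2 fun X x => X.obj.funMap_mono F fun i => termClass_le_iff.1 (h i) X x

noncomputable instance : L.Structure (FreeCarrier E α) where
  funMap F x := termClass E (FirstOrder.Language.Term.func F fun i => termRep (x i))
  RelMap _ _ := False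

theorem termClass_func {n : ℕ} (F : L.Functions n) (s : Fin n → L.Term α) :
    termClass E (FirstOrder.Language.Term.func F s) = funMap F fun i => termClass E (s i) :=
  le_antisymm (termClass_func_mono F fun _ => (termClass_termRep _).ge)
    (termClass_func_mono F fun _ => (termClass_termRep _).le)

theorem termClass_eq_realize (t : L.Term α) :
    termClass E t = t.realize fun a => termClass E (FirstOrder.Language.Term.var a) := by
  induction t with
  | var a => rfl
  | func F ts ih =>
    rw [termClass_func, FirstOrder.Language.Term.realize_func]
    exact congrArg _ (funext ih)

/-- The interpretation of classes of terms. -/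
noncomputable def realizeClass (X : Variety E) (x : α → X.obj.carrier) :
    FreeCarrier E α →o X.obj.carrier where
  toFun q := (termRep q).realize x
  monotone' p q h := by
    rw [← termClass_termRep p, ← termClass_termRep q] at h
    exact termClass_le_iff.1 h X x

theorem realizeClass_termClass (X : Variety E) (x : α → X.obj.carrier) (t : L.Term α) :
    realizeClass X x (termClass E t) = t.realize x :=
  have h := termClass_termRep (termClass E t)
  le_antisymm (termClass_le_iff.1 h.le X x) (termClass_le_iff.1 h.ge X x)

theorem realizeClass_funMap (X : Variety E) (x : α → X.obj.carrier) {n : ℕ}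
    (F : L.Functions n) (q : Fin n → FreeCarrier E α) :
    realizeClass X x (funMap F q) = funMap F fun i => realizeClass X x (q i) :=
  realizeClass_termClass X x _

end FreeTerm

/-- The free algebra on a set of generators. -/
noncomputable def free (E : Set (L.Term ℕ × L.Term ℕ)) (α : Type u) : Variety E :=
  let T : OrdAlg L :=
    { carrier := FreeCarrier E α
      funMap_mono := fun F _ _ h => termClass_func_mono F fun i => by
        rw [termClass_termRep, termClass_termRep]
        exact h i }
  ⟨T, OrdAlg.satisfies_of_reflects (ι := Σ X : Variety E, α → X.obj.carrier) (fun i => i.1)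
    (fun i => ⟨realizeClass i.1 i.2, realizeClass_funMap i.1 i.2⟩) fun a b h => by
      rw [← termClass_termRep a, ← termClass_termRep b]
      exact termClass_le_iff.2 fun X x => h ⟨X, x⟩⟩

variable {α : Type u}

/-- The generators of a free algebra. -/
def gen (E : Set (L.Term ℕ × L.Term ℕ)) (a : α) : (free E α).obj.carrier :=
  termClass E (FirstOrder.Language.Term.var a)

/-- The homomorphism from a free algebra with given values on the generators. -/
noncomputable def lift {X : Variety E} (x : α → X.obj.carrier) : free E α ⟶ X :=
  mkHom (realizeClass X x) (realizeClass_funMap X x)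

@[simp]
theorem lift_gen {X : Variety E} (x : α → X.obj.carrier) (a : α) :
    app (lift x) (gen E a) = x a :=
  realizeClass_termClass X x _

/-- The order between homomorphisms out of a free algebra is detected on the generators. -/
theorem free_hom_le {X : Variety E} {g g' : free E α ⟶ X}
    (h : ∀ a, app g (gen E a) ≤ app g' (gen E a)) : g ≤ g' := by
  intro q
  have hq : q = (termRep q).realize (gen E) :=
    (termClass_termRep q).symm.trans (termClass_eq_realize _)
  change g.hom.toOrderHom q ≤ g'.hom.toOrderHom q
  rw [hq, OrdAlg.Hom.map_realize, OrdAlg.Hom.map_realize]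
  exact OrdAlg.realize_mono _ h

theorem free_hom_ext {X : Variety E} {g g' : free E α ⟶ X}
    (h : ∀ a, app g (gen E a) = app g' (gen E a)) : g = g' :=
  le_antisymm (free_hom_le fun a => (h a).le) (free_hom_le fun a => (h a).ge)

theorem isRetractOfFreeOnFiniteDiscrete_iff (A : Variety E) :
    IsRetractOfFreeOnFiniteDiscrete A ↔
      ∃ P : Type u, Finite P ∧ Nonempty (Retract A (free E P)) := by
  constructor
  · rintro ⟨P, _, B, η, hP, hd, hB, ⟨r⟩⟩
    obtain ⟨h, hh, -⟩ := hB (free E P) ⟨gen E, fun x y hxy => (hd x y hxy ▸ le_rfl)⟩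
    have key : h ≫ lift η = 𝟙 B := by
      refine (hB B η).unique (fun p => ?_) fun p => rfl
      have : app (lift η) (app h (η p)) = η p := by
        rw [hh p]
        exact lift_gen _ _
      exact this
    exact ⟨P, hP, ⟨r.trans ⟨h, lift η, key⟩⟩⟩
  · rintro ⟨P, hP, ⟨r⟩⟩
    let _ : PartialOrder P :=
      { le := Eq
        le_refl := fun _ => rfl
        le_trans := fun _ _ _ => Eq.trans
        le_antisymm := fun _ _ h _ => h }
    refine ⟨P, inferInstance, free E P, ⟨gen E, fun x y hxy => ?_⟩, hP, fun _ _ h => h, ?_, ⟨r⟩⟩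
    · have : x = y := hxy
      rw [this]
    · exact fun X f => ⟨lift f, lift_gen f, fun g hg =>
        free_hom_ext fun a => (hg a).trans (lift_gen (X := X) f a).symm⟩

end Variety

/-! ### The forgetful functor preserves sifted colimits -/

/-- A term depends on finitely many variables only. -/
theorem exists_realize_congr (t : L.Term ℕ) : ∃ N : ℕ, ∀ (M : Type u) [L.Structure M]
    (x y : ℕ → M), (∀ i ≤ N, x i = y i) → t.realize x = t.realize y := by
  induction t with
  | var a => exact ⟨a, fun M _ x y h => h a le_rfl⟩
  | func F ts ih =>
    choose N hN using ih
    refine ⟨Finset.univ.sup N, fun M _ x y h => ?_⟩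
    simp only [FirstOrder.Language.Term.realize_func]
    exact congrArg _ (funext fun i => hN i M x y fun k hk =>
      h k (hk.trans (Finset.le_sup (Finset.mem_univ i))))

section Sifted

variable {J : Type u} [Category.{u} J] [PosCategory J] {W : Jᵒᵖ ⥤ PartOrd.{u}}

/-- Finitely many elements of a sifted colimit of posets come from a common stage and a common
element of the weight. -/
theorem IsSiftedWeight.exists_common_stage (hW : IsSiftedWeight W) {G : J ⥤ PartOrd.{u}}
    [hG : IsPosFunctor G] {c : WeightedCocone W G} (hc : c.IsColimit) {n : ℕ}
    (y : Fin n → c.pt) : ∃ (j : J) (w : W.obj (op j)) (x : Fin n → G.obj j),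
      ∀ i, c.leg j w (x i) = y i := by
  obtain ⟨j, w, x, h⟩ := (hW n (fun _ => G) (fun _ => hG) (fun _ => c)
    (fun _ => hc)).jointly_surjective (show (prodCocone (fun _ => G) fun _ => c).pt from y)
  exact ⟨j, w, x, fun i => congrFun h i⟩

instance (D : J ⥤ Variety E) [hD : IsPosFunctor D] : IsPosFunctor (D ⋙ Variety.forget E) where
  map_mono h := IsPosFunctor.map_mono (F := Variety.forget E) (hD.map_mono h)

/-- The operations of a diagram of algebras descend to a sifted colimit of underlying posets: they
form a cocone under the powers of the diagram, whose colimit is a power of the colimit. -/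
theorem IsSiftedWeight.exists_operation (hW : IsSiftedWeight W) (D : J ⥤ Variety E)
    [IsPosFunctor D] {c : WeightedCocone W (D ⋙ Variety.forget E)} (hc : c.IsColimit) {n : ℕ}
    (F : L.Functions n) : ∃ o : (Fin n → c.pt) →o c.pt,
      ∀ (j : J) (w : W.obj (op j)) (x : Fin n → (D.obj j).obj.carrier),
        o (fun i => c.leg j w (x i)) = c.leg j w (funMap F x : (D.obj j).obj.carrier) := by
  obtain ⟨g, hg⟩ := (hW n (fun _ => D ⋙ Variety.forget E) (fun _ => inferInstance) (fun _ => c)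
    (fun _ => hc)).exists_desc
    { pt := c.pt
      leg := fun j w => PartOrd.ofHom
        ⟨fun x => c.leg j w (funMap F (x : Fin n → (D.obj j).obj.carrier) : (D.obj j).obj.carrier),
          fun _ _ h => (c.leg j w).hom.monotone ((D.obj j).obj.funMap_mono F h)⟩
      leg_mono := fun j _ _ h x => c.leg_mono j h _
      naturality := fun {i j} f w => by
        ext x
        refine Eq.trans ?_ (c.naturality_apply f w
          (funMap F (x : Fin n → (D.obj i).obj.carrier) : (D.obj i).obj.carrier))
        exact congrArg (fun t => c.leg j w t) (Variety.app_funMap (D.map f) F x).symm }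
  exact ⟨g.hom, fun j w x => congrArg (fun t => t.hom x) (hg j w)⟩

/-- A sifted colimit of the underlying posets of a diagram of algebras carries a structure of an
algebra in the variety for which the legs are homomorphisms. It satisfies the inequations because
each of them involves finitely many elements, which come from a common stage. -/
theorem IsSiftedWeight.exists_algebra (hW : IsSiftedWeight W) (D : J ⥤ Variety E)
    [IsPosFunctor D] {c : WeightedCocone W (D ⋙ Variety.forget E)} (hc : c.IsColimit) :
    ∃ (_ : L.Structure c.pt)
      (hm : ∀ {n : ℕ} (F : L.Functions n), Monotone (funMap F : (Fin n → c.pt) → c.pt)),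
      OrdAlg.Satisfies E ⟨c.pt, hm⟩ ∧
      ∀ (j : J) (w : W.obj (op j)) {n : ℕ} (F : L.Functions n)
        (x : Fin n → (D.obj j).obj.carrier),
        c.leg j w (funMap F x : (D.obj j).obj.carrier) =
          funMap F fun i => c.leg j w (x i) := by
  choose o ho using fun (n : ℕ) (F : L.Functions n) => hW.exists_operation D hc F
  let str : L.Structure c.pt := { funMap := fun F => o _ F, RelMap := fun _ _ => False }
  refine ⟨str, fun F => (o _ F).monotone, fun p hp x => ?_, fun j w n F x => (ho n F j w x).symm⟩
  obtain ⟨N₁, h₁⟩ := exists_realize_congr p.1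
  obtain ⟨N₂, h₂⟩ := exists_realize_congr p.2
  -- the index set is nonempty, so that the chosen values extend to all variables
  let N := max N₁ N₂
  obtain ⟨j, w, z, hz⟩ := hW.exists_common_stage hc (fun i : Fin (N + 1) => (x i : c.pt))
  let y : ℕ → (D.obj j).obj.carrier := fun k => z ⟨min k N, by omega⟩
  have hy : ∀ k ≤ N, x k = c.leg j w (y k) := fun k hk => by
    refine Eq.trans ?_ (hz ⟨min k N, by omega⟩).symm
    simp [min_eq_left hk]
  let f : OrdAlg.Hom (D.obj j).obj ⟨c.pt, fun F => (o _ F).monotone⟩ :=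
    ⟨(c.leg j w).hom, fun {n} F x => (ho n F j w x).symm⟩
  rw [h₁ c.pt x (fun k => f.toOrderHom (y k)) fun k hk => hy k (hk.trans (le_max_left _ _)),
    h₂ c.pt x (fun k => f.toOrderHom (y k)) fun k hk => hy k (hk.trans (le_max_right _ _))]
  have := f.toOrderHom.monotone ((D.obj j).property p hp y)
  rwa [OrdAlg.Hom.map_realize, OrdAlg.Hom.map_realize] at this

theorem preservesWeightedColimits_forget (hW : IsSiftedWeight W) :
    PreservesWeightedColimits (Variety.forget E) W := by
  intro D _ c hc
  let q := colimitCocone W (D ⋙ Variety.forget E)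
  have hq : q.IsColimit := isColimit_colimitCocone W _
  obtain ⟨str, hm, hsat, hleg⟩ := hW.exists_algebra D hq
  let Q : Variety E := ⟨⟨q.pt, hm⟩, hsat⟩
  obtain ⟨g, hg⟩ := hc.exists_desc
    { pt := Q
      leg := fun j w => Variety.mkHom (Y := Q) (q.leg j w).hom (hleg j w)
      leg_mono := fun j _ _ h x => q.leg_mono j h x
      naturality := fun f w => Variety.hom_ext_app fun x => q.naturality_apply f w x }
  obtain ⟨h, hh⟩ := hq.exists_desc (c.map (Variety.forget E))
  have hh' : ∀ j w (x : (D.obj j).obj.carrier), h (q.leg j w x) = Variety.app (c.leg j w) x :=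
    fun j w x => congrArg (fun t => t.hom x) (hh j w)
  let h' : Q ⟶ c.pt := Variety.mkHom (X := Q) h.hom fun {n} F y => by
    obtain ⟨j, w, x, hx⟩ := hW.exists_common_stage hq y
    obtain rfl : (fun i => q.leg j w (x i)) = y := funext hx
    refine (congrArg h (hleg j w F x).symm).trans ((hh' j w _).trans ?_)
    exact (Variety.app_funMap _ F _).trans
      (congrArg (funMap F) (funext fun i => (hh' j w (x i)).symm))
  have key : g ≫ h' = 𝟙 c.pt := by
    have : ∀ j w, c.leg j w ≫ g ≫ h' = c.leg j w ≫ 𝟙 c.pt := fun j w => by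
      rw [← Category.assoc, hg, Category.comp_id]
      exact Variety.hom_ext_app (hh' j w)
    exact le_antisymm (hc.le_of_le _ _ fun j w => (this j w).le)
      (hc.le_of_le _ _ fun j w => (this j w).ge)
  refine hq.of_retract (𝟙 _) (𝟙 _) (Category.id_comp _) ((Variety.forget E).map g) h ?_ ?_ ?_
  · exact congrArg (Variety.forget E).map key
  · exact fun j w => congrArg (Variety.forget E).map (hg j w)
  · exact hh

/-- The hom-functor of a retract of the free algebra on `n` generators is a retract of the `n`-th
power of the forgetful functor, which preserves sifted colimits. -/
theorem isPerfectlyPresentable_of_retract_free {A : Variety E} {P : Type u} [Finite P]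
    (r : Retract A (Variety.free E P)) : IsPerfectlyPresentable A := by
  intro J _ _ W _ hW D _ c hc
  let e := Finite.equivFin P
  have hd := hW (Nat.card P) (fun _ => D ⋙ Variety.forget E) (fun _ => inferInstance)
    (fun _ => c.map (Variety.forget E)) (fun _ => preservesWeightedColimits_forget hW D c hc)
  -- a homomorphism out of the retract is sent to the values on the generators of its extension
  let a : ∀ X : Variety E, (A ⟶ X) →o (Fin (Nat.card P) → X.obj.carrier) := fun X =>
    ⟨fun f i => Variety.app f (Variety.app r.r (Variety.gen E (e.symm i))), fun _ _ h i => h _⟩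
  let b : ∀ X : Variety E, (Fin (Nat.card P) → X.obj.carrier) →o (A ⟶ X) := fun X =>
    ⟨fun x => r.i ≫ Variety.lift fun p => x (e p), fun x y h =>
      PosCategory.comp_mono le_rfl (Variety.free_hom_le fun p => by
        rw [Variety.lift_gen, Variety.lift_gen]
        exact h (e p))⟩
  have hab : ∀ X f, b X (a X f) = f := fun X f => by
    have : Variety.lift (fun p => a X f (e p)) = r.r ≫ f := Variety.free_hom_ext fun p => by
      rw [Variety.lift_gen, Variety.app_comp]
      change Variety.app f (Variety.app r.r (Variety.gen E (e.symm (e p)))) = _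
      rw [e.symm_apply_apply]
    change r.i ≫ Variety.lift (fun p => a X f (e p)) = f
    rw [this, r.retract_assoc]
  have ha : ∀ {X Y : Variety E} (k : X ⟶ Y) (f : A ⟶ X),
      a Y (f ≫ k) = fun i => Variety.app k (a X f i) := fun k f => rfl
  have hb : ∀ {X Y : Variety E} (k : X ⟶ Y) (x : Fin (Nat.card P) → X.obj.carrier),
      b X x ≫ k = b Y fun i => Variety.app k (x i) := fun {X Y} k x => by
    refine (Category.assoc _ _ _).trans (congrArg (r.i ≫ ·) ?_)
    exact Variety.free_hom_ext fun p => by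
      rw [Variety.app_comp, Variety.lift_gen, Variety.lift_gen]
  refine hd.of_retract
    { app := fun j => PartOrd.ofHom (a (D.obj j))
      naturality := fun i j f => rfl }
    { app := fun j => PartOrd.ofHom (b (D.obj j))
      naturality := fun i j f => by
        ext x
        exact (hb (D.map f) x).symm }
    ?_ (PartOrd.ofHom (a c.pt)) (PartOrd.ofHom (b c.pt)) ?_ ?_ ?_
  · ext j f
    exact hab _ f
  · ext f
    exact hab _ f
  · exact fun _ _ => rfl
  · intro j w
    ext x
    exact (hb (c.leg j w) x).symm

end Sifted

/-! ### Perfectly presentable algebras are subregular projectives -/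

/-- The action of the monotone endomaps of the two-element chain on an order kernel, by
composition. -/
def orderKernelDiagram {X Y : Variety E} (e : X ⟶ Y) : IntervalShape.{u} ⥤ Variety E where
  obj _ := Variety.orderKernel e
  map f := Variety.mkHom
    ⟨fun t => ⟨fun w => t.1 (OrderHom.toFun f w), fun _ _ h => t.2 (OrderHom.monotone f h)⟩,
      fun _ _ h _ => Subtype.coe_le_coe.2 h _⟩ fun _ _ => rfl
  map_id _ := rfl
  map_comp _ _ := rfl

instance {X Y : Variety E} (e : X ⟶ Y) : IsPosFunctor (orderKernelDiagram e) :=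
  IntervalShape.isPosFunctor _

/-- The cocone under the order kernel of a homomorphism given by that homomorphism. -/
def orderKernelCocone {X Y : Variety E} (e : X ⟶ Y) :
    WeightedCocone IntervalShape.weight (orderKernelDiagram e) where
  pt := Y
  leg _ w := Variety.orderKernelProj e w ≫ e
  leg_mono _ _ _ h t := t.2 h
  naturality _ _ := rfl

theorem isColimit_orderKernelCocone {X Y : Variety E} {e : X ⟶ Y}
    (he : Function.Surjective (Variety.app e)) : (orderKernelCocone e).IsColimit where
  exists_desc s := by
    -- every leg is determined by the restriction of one of them to the diagonal
    let k : X ⟶ s.pt := Variety.orderKernelDiag e ≫ s.leg .star ⟨false⟩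
    have hk : ∀ (t : (Variety.orderKernel e).obj.carrier) (w : ULift.{u} Bool),
        Variety.app k (t.1 w) = Variety.app (s.leg .star w) t := fun t w =>
      congrArg (fun f => Variety.app f t) (s.naturality (IntervalShape.const w) ⟨false⟩)
    obtain ⟨g, hg⟩ := Variety.exists_factor he k fun x x' h => by
      have h₀ := hk (Variety.orderKernelPair e h) ⟨false⟩
      have h₁ := hk (Variety.orderKernelPair e h) ⟨true⟩
      refine h₀.trans_le (le_of_le_of_eq ?_ h₁.symm)
      exact s.leg_mono .star (show (⟨false⟩ : ULift.{u} Bool) ≤ ⟨true⟩ from Bool.false_le _) _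
    refine ⟨g, fun j w => Variety.hom_ext_app fun t => ?_⟩
    exact (congrArg (fun f => Variety.app f (t.1 w)) hg).trans (hk t w)
  le_of_le g g' h := Variety.le_of_surjective he fun x =>
    h .star ⟨false⟩ (Variety.app (Variety.orderKernelDiag e) x)

theorem IsPerfectlyPresentable.isSubregularProjective {A : Variety E}
    (hA : IsPerfectlyPresentable A) : IsSubregularProjective A := by
  intro X Y e he
  rw [Variety.isSubregularEpi_iff_surjective] at he
  have := hA IntervalShape IntervalShape.weight IntervalShape.isSiftedWeight_weight
    (orderKernelDiagram e) (orderKernelCocone e) (isColimit_orderKernelCocone he)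
  refine isSubregularEpi_of_surjective fun f => ?_
  obtain ⟨j, w, t, h⟩ := this.jointly_surjective f
  let t' : A ⟶ Variety.orderKernel e := t
  have h' : t' ≫ Variety.orderKernelProj e w ≫ e = f := h
  exact ⟨t' ≫ Variety.orderKernelProj e w, (Category.assoc _ _ _).trans h'⟩

theorem IsPerfectlyPresentable.isFinitelyPresentable {A : Variety E}
    (hA : IsPerfectlyPresentable A) : IsFinitelyPresentable A := by
  intro J _ _ _
  have : IsPosFunctor (terminalWeight J) := ⟨fun _ => le_rfl⟩
  exact hA J (terminalWeight J) isSiftedWeight_terminalWeight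

/-! ### Finitely presentable subregular projectives -/

/-- The category of finite subsets of a type, with discrete hom-posets. -/
instance finsetPosCategory (α : Type u) : PosCategory (Finset α) where
  homOrder _ _ :=
    { le := Eq
      le_refl := fun _ => rfl
      le_trans := fun _ _ _ => Eq.trans
      le_antisymm := fun _ _ h _ => h }
  comp_mono := fun _ _ => Subsingleton.elim _ _

/-- The diagram of the free algebras on the finite subsets of a type. -/
noncomputable def freeDiagram (E : Set (L.Term ℕ × L.Term ℕ)) (α : Type u) :
    Finset α ⥤ Variety E where
  obj S := Variety.free E {a // a ∈ S}
  map f := Variety.lift fun a => Variety.gen E ⟨a.1, leOfHom f a.2⟩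
  map_id S := Variety.free_hom_ext fun a => Variety.lift_gen _ a
  map_comp f g := Variety.free_hom_ext fun a => by
    rw [Variety.app_comp, Variety.lift_gen, Variety.lift_gen, Variety.lift_gen]

instance (α : Type u) : IsPosFunctor (freeDiagram E α) where
  map_mono {_ _ f g} _ := by
    rw [Subsingleton.elim f g]

/-- The free algebra on a type, as a cocone under the free algebras on its finite subsets. -/
noncomputable def freeCocone (E : Set (L.Term ℕ × L.Term ℕ)) (α : Type u) :
    WeightedCocone (terminalWeight (Finset α)) (freeDiagram E α) where
  pt := Variety.free E α
  leg _ _ := Variety.lift fun a => Variety.gen E a.1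
  leg_mono _ _ _ _ := le_rfl
  naturality {S T} f _ := Variety.free_hom_ext fun a => by
    change Variety.app (Variety.lift _) (Variety.app (Variety.lift _) _) = _
    rw [Variety.lift_gen, Variety.lift_gen, Variety.lift_gen]

theorem isColimit_freeCocone (α : Type u) : (freeCocone E α).IsColimit where
  exists_desc s := by
    let x : α → s.pt.obj.carrier := fun a =>
      Variety.app (s.leg {a} ⟨⟩) (Variety.gen E ⟨a, Finset.mem_singleton_self a⟩)
    refine ⟨Variety.lift x, fun S _ => Variety.free_hom_ext fun a => ?_⟩
    change Variety.app (Variety.lift x) (Variety.app (Variety.lift _) _) = _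
    rw [Variety.lift_gen, Variety.lift_gen]
    have h : ({a.1} : Finset α) ≤ S := Finset.singleton_subset_iff.2 a.2
    have := congrArg (fun f => Variety.app f (Variety.gen E ⟨a.1, Finset.mem_singleton_self a.1⟩))
      (s.naturality (homOfLE h) ⟨⟩)
    refine this.symm.trans (congrArg (Variety.app (s.leg S ⟨⟩)) ?_)
    exact Variety.lift_gen _ _
  le_of_le g g' h := Variety.free_hom_le fun a => by
    have hgen := Variety.lift_gen (fun b : {b // b ∈ ({a} : Finset α)} => Variety.gen E b.1)
      ⟨a, Finset.mem_singleton_self a⟩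
    rw [← hgen]
    exact h {a} ⟨⟩ (Variety.gen E ⟨a, Finset.mem_singleton_self a⟩)

/-- Projectivity splits the canonical homomorphism from the free algebra on the set of all elements,
and finite presentability lets the section factor through finitely many generators. -/
theorem exists_retract_free {A : Variety E} (hf : IsFinitelyPresentable A)
    (hp : IsSubregularProjective A) :
    ∃ P : Type u, Finite P ∧ Nonempty (Retract A (Variety.free E P)) := by
  classical
  let e : Variety.free E A.obj.carrier ⟶ A := Variety.lift id
  have he : Function.Surjective (Variety.app e) := fun a => ⟨Variety.gen E a, Variety.lift_gen _ a⟩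
  obtain ⟨s, hs⟩ := (hp e ((Variety.isSubregularEpi_iff_surjective e).2 he)).surjective
    (show A ⟶ A from 𝟙 A)
  obtain ⟨S, w, t, ht⟩ := (hf (Finset A.obj.carrier) (freeDiagram E _) (freeCocone E _)
    (isColimit_freeCocone _)).jointly_surjective s
  let t' : A ⟶ Variety.free E {a // a ∈ S} := t
  have ht' : t' ≫ (freeCocone E _).leg S w = s := ht
  have hs' : (show A ⟶ Variety.free E A.obj.carrier from s) ≫ e = 𝟙 A := hs
  refine ⟨{a // a ∈ S}, inferInstance, ⟨⟨t', (freeCocone E _).leg S w ≫ e, ?_⟩⟩⟩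
  exact (Category.assoc _ _ _).symm.trans ((congrArg (· ≫ e) ht').trans hs')

end PosEnriched

theorem proposition5p11 {L : FirstOrder.Language.{u, v}} [L.IsAlgebraic]
    (E : Set (L.Term ℕ × L.Term ℕ)) (A : PosEnriched.Variety E) :
    List.TFAE
      [PosEnriched.IsPerfectlyPresentable A,
       PosEnriched.IsFinitelyPresentable A ∧ PosEnriched.IsSubregularProjective A,
       PosEnriched.IsRetractOfFreeOnFiniteDiscrete A] := by
  rw [PosEnriched.Variety.isRetractOfFreeOnFiniteDiscrete_iff]
  tfae_have 1 → 2 := fun h => ⟨h.isFinitelyPresentable, h.isSubregularProjective⟩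
  tfae_have 2 → 3 := fun h => PosEnriched.exists_retract_free h.1 h.2
  tfae_have 3 → 1 := fun ⟨_, _, ⟨r⟩⟩ => PosEnriched.isPerfectlyPresentable_of_retract_free r
  tfae_finish
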